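/- For $n,m\in\mathbb Z_+=\{0,1,2,\dots\}$ let $A(n,m)=(A_{i,j}(n,m))_{i,j=1}^3$ be complex $3\times 3$ matrices, and let $$L_{n,m}=\begin{pmatrix} z+A_{1,1}(n+1,m)-A_{1,1}(n,m) & -A_{1,2}(n,m) & -A_{1,3}(n,m)\\ A_{2,1}(n+1,m)&0&0\\ A_{3,1}(n+1,m)&0&1\end{pmatrix},\qquad M_{n,m}=\begin{pmatrix} z+A_{1,1}(n,m+1)-A_{1,1}(n,m) & -A_{1,2}(n,m) & -A_{1,3}(n,m)\\ A_{2,1}(n,m+1)&1&0\\ A_{3,1}(n,m+1)&0&0\end{pmatrix}.$$ Put $$c_{n,m}=A_{1,1}(n,m)-A_{1,1}(n+1,m),\quad d_{n,m}=A_{1,1}(n,m)-A_{1,1}(n,m+1),\quad a_{n,m}=A_{2,1}(n,m)A_{1,2}(n,m),\quad b_{n,m}=A_{3,1}(n,m)A_{1,3}(n,m).$$ Suppose that all matrices $L_{n,m}$, $M_{n,m}$ $(n,m\ge 0)$ are invertible, that the zero curvature condition $$0=L_{n,m+1}M_{n,m}-M_{n+1,m}L_{n,m},\qquad n,m\ge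 0,$$ holds, and that the boundary conditions $a_{0,m}=0=b_{n,0}$ hold for all $n,m\ge0$. Then $a_{n,m}\ne0$ for $n\ge1$, $m\ge0$, and $b_{n,m}\neq 0$ for $n\ge0$, $m\ge1$; there is exactly one family of polynomials $P_{n,m}$, $n,m\ge0$, with $P_{0,0}=1$ and $$P_{n+1,m}(z)=(z-c_{n,m})P_{n,m}(z)-a_{n,m}P_{n-1,m}(z)-b_{n,m}P_{n,m-1}(z),$$ $$P_{n,m+1}(z)=(z-d_{n,m})P_{n,m}(z)-a_{n,m}P_{n-1,m}(z)-b_{n,m}P_{n,m-1}(z)$$ for all $n,m\ge0$ (where $P_{-1,m}=P_{n,-1}=0$); and there are two formal Laurent series at infinity $$f_j(z)=\sum_{k=0}^\infty \frac{s_{j,k}}{z^{k+1}},\qquad s_{j,k}\in\mathbb C,\quad j=1,2,$$ forming a perfect system, such that for all $n,m\ge0$ the polynomial $P_{n,m}$ is the monic Hermite–Padé polynomial of $(f_1,f_2)$ with multi-index $(n,m)$. Here a polynomial $P$ solves the Hermite–Padé problem for $(f_1,f_2)$ with multi-index $(n,m)$ if $\deg P\le n+m$ and there are polynomials $Q_1,Q_2$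 with $$f_1P-Q_1=\mathcal O\bigl(z^{-n-1}\bigr),\qquad f_2P-Q_2=\mathcal O\bigl(z^{-m-1}\bigr)$$ (as formal series in $1/z$). The multi-index is normal if nontrivial solutions exist, are unique up to a multiplicative constant, and all have degree exactly $n+m$; the system $(f_1,f_2)$ is perfect if all multi-indices $(n,m)$, $n,m\ge0$, are normal. The monic Hermite–Padé polynomial of a normal multi-index is its unique monic solution. -/

import Mathlib

open Polynomial

noncomputable section

namespace HermitePade

/-! ### Formal Laurent series at infinity

A formal Laurent series in `1/z` is an element of `LaurentSeries ℂ`, the formal variable of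
`LaurentSeries` standing for `1/z`: the coefficient at `i : ℤ` is the coefficient of `1/z^i`. -/

/-- The formal Laurent series at infinity `∑ k, s k / z^(k+1)`. -/
def seriesAtInfinity (s : ℕ → ℂ) : LaurentSeries ℂ :=
  HahnSeries.ofPowerSeries ℤ ℂ (PowerSeries.X * PowerSeries.mk s)

/-- A polynomial in `z`, regarded as a formal Laurent series in `1/z`
(`single (-1) 1` is the series `z`). -/
def polyAtInfinity (P : ℂ[X]) : LaurentSeries ℂ :=
  P.eval₂ HahnSeries.C (HahnSeries.single (-1 : ℤ) (1 : ℂ))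

/-- `R = O(1/z^k)` as `z → ∞`: the series has no terms `1/z^i` with `i < k`. -/
def IsBigOInvPow (R : LaurentSeries ℂ) (k : ℕ) : Prop :=
  ∀ i : ℤ, i < (k : ℤ) → R.coeff i = 0

/-! ### Hermite–Padé approximation (type II) of a pair of series -/

/-- `P` solves the type II Hermite–Padé problem for `(f₁, f₂)` with multi-index `(n, m)`:
`deg P ≤ n + m`, and there are polynomials `Q₁`, `Q₂` with
`f₁ P - Q₁ = O(1/z^(n+1))` and `f₂ P - Q₂ = O(1/z^(m+1))`. -/
def IsSolution (f₁ f₂ : LaurentSeries ℂ) (n m : ℕ) (P : ℂ[X]) : Prop :=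
  P.degree ≤ ((n + m : ℕ) : WithBot ℕ) ∧
  (∃ Q₁ : ℂ[X], IsBigOInvPow (f₁ * polyAtInfinity P - polyAtInfinity Q₁) (n + 1)) ∧
  (∃ Q₂ : ℂ[X], IsBigOInvPow (f₂ * polyAtInfinity P - polyAtInfinity Q₂) (m + 1))

/-- The multi-index `(n, m)` is normal: there is a nontrivial solution, the solution is unique up
to a multiplicative constant, and every nontrivial solution has full degree `n + m`. -/
def IsNormalIndex (f₁ f₂ : LaurentSeries ℂ) (n m : ℕ) : Prop :=
  (∃ P : ℂ[X], P ≠ 0 ∧ IsSolution f₁ f₂ n m P) ∧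
  (∀ P Q : ℂ[X], IsSolution f₁ f₂ n m P → P ≠ 0 → IsSolution f₁ f₂ n m Q →
    ∃ c : ℂ, Q = C c * P) ∧
  (∀ P : ℂ[X], IsSolution f₁ f₂ n m P → P ≠ 0 → P.natDegree = n + m)

/-- `(f₁, f₂)` is a perfect system: all multi-indices are normal. -/
def IsPerfectSystem (f₁ f₂ : LaurentSeries ℂ) : Prop :=
  ∀ n m : ℕ, IsNormalIndex f₁ f₂ n m

/-- `P` is a (monic) Hermite–Padé polynomial of `(f₁, f₂)` with multi-index `(n, m)`. For a normal
index there is exactly one such polynomial. -/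
def IsHermitePadePolynomial (f₁ f₂ : LaurentSeries ℂ) (n m : ℕ) (P : ℂ[X]) : Prop :=
  P.Monic ∧ IsSolution f₁ f₂ n m P

/-! ### The transition matrices

`A n m` is a `3 × 3` array of complex numbers attached to the vertex `(n, m)`. The rows and columns
`1, 2, 3` of the usual notation are `0, 1, 2` here, and the spectral parameter `z` is `X`. -/

/-- The transition matrix from `(n, m)` to `(n + 1, m)`. -/
def matL (A : ℕ → ℕ → Matrix (Fin 3) (Fin 3) ℂ) (n m : ℕ) : Matrix (Fin 3) (Fin 3) ℂ[X] :=
  !![X + C (A (n + 1) m 0 0 - A n m 0 0), C (-A n m 0 1), C (-A n m 0 2);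
     C (A (n + 1) m 1 0),                 0,              0;
     C (A (n + 1) m 2 0),                 0,              1]

/-- The transition matrix from `(n, m)` to `(n, m + 1)`. -/
def matM (A : ℕ → ℕ → Matrix (Fin 3) (Fin 3) ℂ) (n m : ℕ) : Matrix (Fin 3) (Fin 3) ℂ[X] :=
  !![X + C (A n (m + 1) 0 0 - A n m 0 0), C (-A n m 0 1), C (-A n m 0 2);
     C (A n (m + 1) 1 0),                 1,              0;
     C (A n (m + 1) 2 0),                 0,              0]

/-- The discrete zero curvature condition on the quadrant `n, m ≥ 0`. -/
def ZeroCurvature (L M : ℕ → ℕ → Matrix (Fin 3) (Fin 3) ℂ[X]) : Prop :=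
  ∀ n m : ℕ, 0 = L n (m + 1) * M n m - M (n + 1) m * L n m

/-! ### The nearest-neighbour recurrence relations -/

/-- The coefficient `c n m`. -/
def coeffC (A : ℕ → ℕ → Matrix (Fin 3) (Fin 3) ℂ) (n m : ℕ) : ℂ := A n m 0 0 - A (n + 1) m 0 0

/-- The coefficient `d n m`. -/
def coeffD (A : ℕ → ℕ → Matrix (Fin 3) (Fin 3) ℂ) (n m : ℕ) : ℂ := A n m 0 0 - A n (m + 1) 0 0

/-- The coefficient `a n m`. -/
def coeffA (A : ℕ → ℕ → Matrix (Fin 3) (Fin 3) ℂ) (n m : ℕ) : ℂ := A n m 1 0 * A n m 0 1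

/-- The coefficient `b n m`. -/
def coeffB (A : ℕ → ℕ → Matrix (Fin 3) (Fin 3) ℂ) (n m : ℕ) : ℂ := A n m 2 0 * A n m 0 2

/-- `P (n - 1) m`, with the convention that a polynomial with index `-1` is `0`. -/
def leftNeighbour (P : ℕ → ℕ → ℂ[X]) : ℕ → ℕ → ℂ[X]
  | 0, _ => 0
  | n + 1, m => P n m

/-- `P n (m - 1)`, with the convention that a polynomial with index `-1` is `0`. -/
def lowerNeighbour (P : ℕ → ℕ → ℂ[X]) : ℕ → ℕ → ℂ[X]
  | _, 0 => 0
  | n, m + 1 => P n m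

/-- The table `P` starts with `P 0 0 = 1` and satisfies, for all `n, m ≥ 0`, the nearest-neighbour
recurrence relations with coefficients `a, b, c, d`. -/
structure SatisfiesRecurrences (a b c d : ℕ → ℕ → ℂ) (P : ℕ → ℕ → ℂ[X]) : Prop where
  init : P 0 0 = 1
  right : ∀ n m : ℕ, P (n + 1) m =
    (X - C (c n m)) * P n m - C (a n m) * leftNeighbour P n m - C (b n m) * lowerNeighbour P n m
  up : ∀ n m : ℕ, P n (m + 1) =
    (X - C (d n m)) * P n m - C (a n m) * leftNeighbour P n m - C (b n m) * lowerNeighbour P n m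

end HermitePade

end

open HermitePade

namespace HermitePade

/-! ### Laurent coefficients and orthogonality -/

/-! The determinants of `matL` and `matM` are free of z, so invertibility says that the off-diagonal
entries occurring in `a` and `b` are nonzero away from the boundary. Zero curvature makes transport
of `(1, 0, 0)` through the lattice path-independent. The first component of the transported vector
is the table `P`, and the boundary conditions identify the other two with multiples of its left and
lower neighbours (`satisfiesRecurrences_waveVector`).

On the bottom row `b = 0` leaves a three-term recurrence with `a ≠ 0`, so Favard's theorem gives a
functional `l₁`. Subtracting the two recurrences gives `P n (m+1) = P (n+1) m + (c - d) P n m`, and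
`c - d ≠ 0` by one entry of the zero curvature equation. This carries the `l₁`-orthogonality, with
its nonvanishing moment, to every row (`HasOrthogonality.of_firstRow`); transposing gives `l₂`. The
series have coefficients `l_j (X ^ k)`. The nonvanishing moments yield uniqueness, hence
perfectness, by descent on the index (`eq_C_mul_of_orthogonality`). -/

theorem coeff_seriesAtInfinity_nat_succ (s : ℕ → ℂ) (k : ℕ) :
    (seriesAtInfinity s).coeff ((k : ℤ) + 1) = s k := by
  have h := HahnSeries.ofPowerSeries_apply_coeff (Γ := ℤ) (PowerSeries.X * PowerSeries.mk s) (k + 1)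
  rw [mul_comm, PowerSeries.coeff_succ_mul_X, PowerSeries.coeff_mk, mul_comm] at h
  simpa [seriesAtInfinity] using h

theorem coeff_seriesAtInfinity_of_nonpos (s : ℕ → ℂ) {i : ℤ} (hi : i ≤ 0) :
    (seriesAtInfinity s).coeff i = 0 := by
  rcases hi.lt_or_eq with hi | rfl
  · unfold seriesAtInfinity
    rw [HahnSeries.ofPowerSeries_apply]
    apply HahnSeries.embDomain_of_notMem_range
    rintro ⟨n, hn⟩
    simp at hn
    omega
  · have h := HahnSeries.ofPowerSeries_apply_coeff (Γ := ℤ)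
      (PowerSeries.X * PowerSeries.mk s) 0
    simpa [seriesAtInfinity] using h

theorem polyAtInfinity_add (P Q : ℂ[X]) :
    polyAtInfinity (P + Q) = polyAtInfinity P + polyAtInfinity Q :=
  eval₂_add _ _

theorem polyAtInfinity_monomial (n : ℕ) (a : ℂ) :
    polyAtInfinity (monomial n a) = HahnSeries.single (-(n : ℤ)) a := by
  rw [polyAtInfinity, eval₂_monomial, HahnSeries.single_pow, HahnSeries.C_apply,
    HahnSeries.single_mul_single]
  simp

theorem coeff_mul_polyAtInfinity (f : LaurentSeries ℂ) (P : ℂ[X]) (i : ℤ) :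
    (f * polyAtInfinity P).coeff i = P.sum fun j a => a * f.coeff (i + j) := by
  induction P using Polynomial.induction_on' with
  | add P Q hP hQ =>
    rw [polyAtInfinity_add, mul_add, HahnSeries.coeff_add, hP, hQ,
      sum_add_index _ _ _ (by simp) (by intros; ring)]
  | monomial n a =>
    rw [polyAtInfinity_monomial, sum_monomial_index _ _ (by simp)]
    have h := HahnSeries.coeff_mul_single_add (r := a) (x := f) (a := i + n) (b := -(n : ℤ))
    rw [add_neg_cancel_right] at h
    rw [h, mul_comm]

theorem coeff_polyAtInfinity_neg (P : ℂ[X]) (n : ℕ) :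
    (polyAtInfinity P).coeff (-(n : ℤ)) = P.coeff n := by
  induction P using Polynomial.induction_on' with
  | add P Q hP hQ => rw [polyAtInfinity_add, HahnSeries.coeff_add, hP, hQ, coeff_add]
  | monomial k a =>
    rw [polyAtInfinity_monomial, HahnSeries.coeff_single, coeff_monomial]
    simp [eq_comm]

theorem coeff_polyAtInfinity_of_pos (P : ℂ[X]) {i : ℤ} (hi : 0 < i) :
    (polyAtInfinity P).coeff i = 0 := by
  induction P using Polynomial.induction_on' with
  | add P Q hP hQ => rw [polyAtInfinity_add, HahnSeries.coeff_add, hP, hQ, add_zero]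
  | monomial k a =>
    rw [polyAtInfinity_monomial, HahnSeries.coeff_single, if_neg (by omega)]

/-- The coefficients of `f P` at negative powers of `z` are the moments of `P`. -/
theorem coeff_moments_mul_polyAtInfinity (l : ℂ[X] →ₗ[ℂ] ℂ) (P : ℂ[X]) (k : ℕ) :
    (seriesAtInfinity (fun j => l (X ^ j)) * polyAtInfinity P).coeff ((k : ℤ) + 1)
      = l (X ^ k * P) := by
  rw [coeff_mul_polyAtInfinity]
  conv_rhs => rw [P.as_sum_support_C_mul_X_pow, Finset.mul_sum, map_sum]
  rw [sum_def]
  refine Finset.sum_congr rfl fun j _ => ?_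
  rw [show (k : ℤ) + 1 + j = ((k + j : ℕ) : ℤ) + 1 by push_cast; ring,
    coeff_seriesAtInfinity_nat_succ, mul_left_comm, ← pow_add, ← smul_eq_C_mul, map_smul,
    smul_eq_mul]

/-- Q can absorb exactly the nonnegative powers of z, so only the moments of P are constrained. -/
theorem exists_isBigOInvPow_iff (l : ℂ[X] →ₗ[ℂ] ℂ) (P : ℂ[X]) (n : ℕ) :
    (∃ Q : ℂ[X], IsBigOInvPow
      (seriesAtInfinity (fun j => l (X ^ j)) * polyAtInfinity P - polyAtInfinity Q) (n + 1)) ↔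
      ∀ k < n, l (X ^ k * P) = 0 := by
  set f := seriesAtInfinity (fun j => l (X ^ j)) with hf
  constructor
  · rintro ⟨Q, hQ⟩ k hk
    have h := hQ ((k : ℤ) + 1) (by push_cast; omega)
    rwa [HahnSeries.coeff_sub, coeff_polyAtInfinity_of_pos Q (by omega), sub_zero,
      coeff_moments_mul_polyAtInfinity] at h
  · intro h
    -- The polynomial part of `f P`; since f starts at 1/z, powers `z^j` with `j ≥ P.natDegree` do
    -- not occur.
    refine ⟨∑ j ∈ Finset.range P.natDegree,
      monomial j ((f * polyAtInfinity P).coeff (-(j : ℤ))), fun i hi => ?_⟩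
    rw [HahnSeries.coeff_sub]
    rcases lt_or_ge 0 i with hpos | hneg
    · obtain ⟨k, rfl⟩ : ∃ k : ℕ, i = (k : ℤ) + 1 := ⟨(i - 1).toNat, by omega⟩
      rw [coeff_polyAtInfinity_of_pos _ hpos, coeff_moments_mul_polyAtInfinity,
        h k (by push_cast at hi; omega), sub_zero]
    · obtain ⟨k, rfl⟩ : ∃ k : ℕ, i = -(k : ℤ) := ⟨(-i).toNat, by omega⟩
      rw [coeff_polyAtInfinity_neg, finsetSum_coeff]
      simp only [coeff_monomial, Finset.sum_ite_eq', Finset.mem_range]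
      split_ifs with hk
      · exact sub_self _
      · rw [sub_zero, coeff_mul_polyAtInfinity, sum_def]
        refine Finset.sum_eq_zero fun j hj => ?_
        have := le_natDegree_of_mem_supp j hj
        rw [hf, coeff_seriesAtInfinity_of_nonpos _ (by omega), mul_zero]

theorem isSolution_moments_iff (l₁ l₂ : ℂ[X] →ₗ[ℂ] ℂ) (n m : ℕ) (P : ℂ[X]) :
    IsSolution (seriesAtInfinity fun j => l₁ (X ^ j)) (seriesAtInfinity fun j => l₂ (X ^ j)) n m P ↔
      P.degree ≤ ((n + m : ℕ) : WithBot ℕ) ∧ (∀ k < n, l₁ (X ^ k * P) = 0) ∧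
        ∀ k < m, l₂ (X ^ k * P) = 0 := by
  rw [IsSolution, exists_isBigOInvPow_iff, exists_isBigOInvPow_iff]

/-! ### Favard's theorem -/

/-- `p n` is orthogonal to the polynomials of degree `< n`, but not to those of degree `n`. -/
def HasOrthogonality (l : ℂ[X] →ₗ[ℂ] ℂ) (n : ℕ) (p : ℂ[X]) : Prop :=
  (∀ k < n, l (X ^ k * p) = 0) ∧ l (X ^ n * p) ≠ 0

theorem monic_natDegree_sub_mul {p q : ℂ[X]} {n : ℕ} (c a : ℂ) (hp : p.Monic ∧ p.natDegree = n)
    (hq : q.degree < ((n + 1 : ℕ) : WithBot ℕ)) :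
    ((X - C c) * p - C a * q).Monic ∧ ((X - C c) * p - C a * q).natDegree = n + 1 := by
  have hm : ((X - C c) * p).Monic := (monic_X_sub_C c).mul hp.1
  have hd : ((X - C c) * p).natDegree = n + 1 := by
    rw [(monic_X_sub_C c).natDegree_mul hp.1, natDegree_X_sub_C, hp.2, add_comm]
  have hlt : (C a * q).degree < ((X - C c) * p).degree := by
    rw [degree_eq_natDegree hm.ne_zero, hd]
    rw [← smul_eq_C_mul]
    exact (degree_smul_le a q).trans_lt hq
  exact ⟨hm.sub_of_left hlt,
    by rw [natDegree_eq_of_degree_eq (degree_sub_eq_left_of_degree_lt hlt), hd]⟩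

theorem degree_lt_of_natDegree_eq {p : ℂ[X]} {k n : ℕ} (hp : p.natDegree = k) (h : k < n) :
    p.degree < (n : WithBot ℕ) :=
  degree_le_natDegree.trans_lt (by rw [hp]; exact_mod_cast h)

theorem monic_natDegree_of_threeTerm {p : ℕ → ℂ[X]} {c a : ℕ → ℂ} (h0 : p 0 = 1)
    (h1 : p 1 = X - C (c 0))
    (h : ∀ n, p (n + 2) = (X - C (c (n + 1))) * p (n + 1) - C (a (n + 1)) * p n) (n : ℕ) :
    (p n).Monic ∧ (p n).natDegree = n := by
  induction n using Nat.twoStepInduction with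
  | zero => simp [h0]
  | one => rw [h1]; exact ⟨monic_X_sub_C _, natDegree_X_sub_C _⟩
  | more n ih ih' =>
    rw [h]
    exact monic_natDegree_sub_mul _ _ ih' (degree_lt_of_natDegree_eq ih.2 (by omega))

/-- Favard's theorem (over `ℂ`, for a quasi-definite functional). -/
theorem exists_functional_of_threeTerm {p : ℕ → ℂ[X]} {c a : ℕ → ℂ} (h0 : p 0 = 1)
    (h1 : p 1 = X - C (c 0))
    (h : ∀ n, p (n + 2) = (X - C (c (n + 1))) * p (n + 1) - C (a (n + 1)) * p n)
    (ha : ∀ n, a (n + 1) ≠ 0) :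
    ∃ l : ℂ[X] →ₗ[ℂ] ℂ, ∀ n, HasOrthogonality l n (p n) := by
  have hp := monic_natDegree_of_threeTerm h0 h1 h
  let S : Polynomial.Sequence ℂ :=
    { elems' := p
      degree_eq' := fun n => by
        rw [degree_eq_natDegree (hp n).1.ne_zero, (hp n).2] }
  have hS : ∀ n, S n = p n := fun _ => rfl
  let B := S.basis fun n => by
    rw [hS, (hp n).1.leadingCoeff]; exact isUnit_one
  have hB : ∀ n, B n = p n := fun n => by simp [B, hS]
  -- The functional is forced up to scale: it must kill every `p n` with `n ≥ 1`.
  let l := B.coord 0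
  have l0 : l (p 0) = 1 := by rw [← hB]; simp [l]
  have lsucc : ∀ n, l (p (n + 1)) = 0 := fun n => by
    rw [← hB]; simp [l]
  -- The recurrence solved for `X * p (n + 1)` trades one power of X for neighbouring indices.
  have step : ∀ k n, l (X ^ (k + 1) * p (n + 1)) =
      l (X ^ k * p (n + 2)) + c (n + 1) * l (X ^ k * p (n + 1)) + a (n + 1) * l (X ^ k * p n) := by
    intro k n
    rw [← smul_eq_mul (c _), ← smul_eq_mul (a _), ← map_smul, ← map_smul, ← map_add, ← map_add,
      h n, smul_eq_C_mul, smul_eq_C_mul]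
    congr 1
    ring
  have orth : ∀ k n, k < n → l (X ^ k * p n) = 0 := by
    intro k
    induction k with
    | zero =>
      intro n hn
      obtain ⟨n, rfl⟩ := Nat.exists_eq_add_one_of_ne_zero hn.ne'
      rw [pow_zero, one_mul, lsucc]
    | succ k ih =>
      intro n hn
      obtain ⟨n, rfl⟩ := Nat.exists_eq_add_one_of_ne_zero (by omega : n ≠ 0)
      rw [step, ih _ (by omega), ih _ (by omega), ih _ (by omega)]
      ring
  refine ⟨l, fun n => ⟨fun k => orth k n, ?_⟩⟩
  induction n with
  | zero => rw [pow_zero, one_mul, l0]; exact one_ne_zero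
  | succ n ih =>
    -- Only the last term survives: the diagonal moment is multiplied by `a (n + 1)`.
    rw [step, orth _ _ (by omega), orth _ _ (by omega)]
    simpa using ⟨ha n, ih⟩

/-! ### Tables of multiple orthogonal polynomials -/

/-- Both terms on the right have vanishing moments below n; at n the first still vanishes, being
orthogonal one order further, and the second contributes a nonzero multiple. -/
theorem HasOrthogonality.of_firstRow {l : ℂ[X] →ₗ[ℂ] ℂ} {P : ℕ → ℕ → ℂ[X]} {δ : ℕ → ℕ → ℂ}
    (h : ∀ n m, P n (m + 1) = P (n + 1) m + C (δ n m) * P n m) (hδ : ∀ n m, δ n m ≠ 0)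
    (h0 : ∀ n, HasOrthogonality l n (P n 0)) (n m : ℕ) : HasOrthogonality l n (P n m) := by
  induction m generalizing n with
  | zero => exact h0 n
  | succ m ih =>
    have key : ∀ k, l (X ^ k * P n (m + 1)) =
        l (X ^ k * P (n + 1) m) + δ n m * l (X ^ k * P n m) := fun k => by
      rw [h, mul_add, map_add, mul_left_comm, ← smul_eq_C_mul, map_smul, smul_eq_mul]
    constructor
    · intro k hk
      rw [key, (ih (n + 1)).1 k (by omega), (ih n).1 k hk, mul_zero, add_zero]
    · rw [key, (ih (n + 1)).1 n (by omega), zero_add]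
      exact mul_ne_zero (hδ n m) (ih n).2

theorem monic_natDegree_of_firstRow {P : ℕ → ℕ → ℂ[X]} {δ : ℕ → ℕ → ℂ}
    (h : ∀ n m, P n (m + 1) = P (n + 1) m + C (δ n m) * P n m)
    (h0 : ∀ n, (P n 0).Monic ∧ (P n 0).natDegree = n) (n m : ℕ) :
    (P n m).Monic ∧ (P n m).natDegree = n + m := by
  induction m generalizing n with
  | zero => exact h0 n
  | succ m ih =>
    obtain ⟨hm, hd⟩ := ih (n + 1)
    have hlt : (C (δ n m) * P n m).degree < (P (n + 1) m).degree := by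
      rw [degree_eq_natDegree hm.ne_zero, hd, ← smul_eq_C_mul]
      exact (degree_smul_le _ _).trans_lt (degree_lt_of_natDegree_eq (ih n).2 (by omega))
    rw [h]
    refine ⟨hm.add_of_left hlt, ?_⟩
    rw [natDegree_add_eq_left_of_degree_lt hlt, hd]
    omega

theorem degree_sub_coeff_mul_le {p Q : ℂ[X]} {N : ℕ} (hp : p.Monic ∧ p.natDegree = N + 1)
    (hQ : Q.degree ≤ ((N + 1 : ℕ) : WithBot ℕ)) :
    (Q - C (Q.coeff (N + 1)) * p).degree ≤ (N : WithBot ℕ) := by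
  rw [degree_le_iff_coeff_zero]
  intro k hk
  have hk : N < k := by exact_mod_cast hk
  rw [coeff_sub, coeff_C_mul]
  rcases (Nat.succ_le_of_lt hk).eq_or_lt with rfl | hk'
  · have := hp.1.coeff_natDegree
    rw [hp.2] at this
    rw [Nat.succ_eq_add_one, this, mul_one, sub_self]
  · have hQk : Q.coeff k = 0 := coeff_eq_zero_of_degree_lt (hQ.trans_lt (by exact_mod_cast hk'))
    have hpk : p.coeff k = 0 := coeff_eq_zero_of_natDegree_lt (by have := hp.2; omega)
    rw [hQk, hpk, mul_zero, sub_zero]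

theorem moment_sub_C_mul (l : ℂ[X] →ₗ[ℂ] ℂ) {p Q : ℂ[X]} {k : ℕ} (c : ℂ)
    (hQ : l (X ^ k * Q) = 0) (hp : l (X ^ k * p) = 0) : l (X ^ k * (Q - C c * p)) = 0 := by
  rw [mul_sub, map_sub, hQ, mul_left_comm, ← smul_eq_C_mul, map_smul, hp, smul_zero, sub_zero]

/-- If `p'` fails the orthogonality relation `l (X ^ k * p') = 0`, which `p` satisfies, then
uniqueness passes from `p'` to `p`. -/
theorem eq_C_mul_of_eq_C_mul {l : ℂ[X] →ₗ[ℂ] ℂ} {p p' Q : ℂ[X]} {k : ℕ} {q : ℂ}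
    (hpk : l (X ^ k * p) = 0) (hp' : l (X ^ k * p') ≠ 0)
    (hQk : l (X ^ k * Q) = 0)
    (h : ∃ c, Q - C q * p = C c * p') : ∃ c, Q = C c * p := by
  obtain ⟨c, hc⟩ := h
  have h1 : l (X ^ k * (Q - C q * p)) = 0 :=
    moment_sub_C_mul l _ hQk hpk
  rw [hc, mul_left_comm, ← smul_eq_C_mul, map_smul, smul_eq_mul] at h1
  have hc0 : c = 0 := (mul_eq_zero.mp h1).resolve_right hp'
  refine ⟨q, ?_⟩
  rw [hc0, C_0, zero_mul] at hc
  exact sub_eq_zero.mp hc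

/-- Descent: removing the leading multiple of the monic polynomial leaves a solution for the
preceding index, hence a multiple of its polynomial. The one orthogonality relation dropped in
passing to that index forces this multiple to be zero. -/
theorem eq_C_mul_of_orthogonality {l₁ l₂ : ℂ[X] →ₗ[ℂ] ℂ} {P : ℕ → ℕ → ℂ[X]}
    (hP : ∀ n m, (P n m).Monic ∧ (P n m).natDegree = n + m)
    (h₁ : ∀ n m, HasOrthogonality l₁ n (P n m)) (h₂ : ∀ n m, HasOrthogonality l₂ m (P n m))
    (n m : ℕ) {Q : ℂ[X]} (hQ : Q.degree ≤ ((n + m : ℕ) : WithBot ℕ))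
    (hQ₁ : ∀ k < n, l₁ (X ^ k * Q) = 0) (hQ₂ : ∀ k < m, l₂ (X ^ k * Q) = 0) :
    ∃ c : ℂ, Q = C c * P n m := by
  induction m generalizing Q with
  | zero =>
    clear hQ₂
    induction n generalizing Q with
    | zero =>
      refine ⟨Q.coeff 0, ?_⟩
      rw [eq_one_of_monic_natDegree_zero (hP 0 0).1 (hP 0 0).2, mul_one]
      exact eq_C_of_degree_le_zero hQ
    | succ n ih =>
      have hd := hP (n + 1) 0
      refine eq_C_mul_of_eq_C_mul ((h₁ (n + 1) 0).1 n (by omega)) (h₁ n 0).2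
        (hQ₁ n (by omega)) (ih (degree_sub_coeff_mul_le hd hQ) fun k hk => ?_)
      exact moment_sub_C_mul _ _ (hQ₁ k (by omega)) ((h₁ (n + 1) 0).1 k (by omega))
  | succ m ih =>
    have hd := hP n (m + 1)
    refine eq_C_mul_of_eq_C_mul ((h₂ n (m + 1)).1 m (by omega)) (h₂ n m).2
      (hQ₂ m (by omega)) (ih (degree_sub_coeff_mul_le hd hQ) (fun k hk => ?_) fun k hk => ?_)
    · exact moment_sub_C_mul _ _ (hQ₁ k hk) ((h₁ n (m + 1)).1 k hk)
    · exact moment_sub_C_mul _ _ (hQ₂ k (by omega)) ((h₂ n (m + 1)).1 k (by omega))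

theorem isHermitePadePolynomial_of_orthogonality {l₁ l₂ : ℂ[X] →ₗ[ℂ] ℂ} {P : ℕ → ℕ → ℂ[X]}
    (hP : ∀ n m, (P n m).Monic ∧ (P n m).natDegree = n + m)
    (h₁ : ∀ n m, HasOrthogonality l₁ n (P n m)) (h₂ : ∀ n m, HasOrthogonality l₂ m (P n m))
    (n m : ℕ) :
    IsHermitePadePolynomial (seriesAtInfinity fun j => l₁ (X ^ j))
      (seriesAtInfinity fun j => l₂ (X ^ j)) n m (P n m) :=
  ⟨(hP n m).1, (isSolution_moments_iff _ _ _ _ _).mpr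
    ⟨degree_le_of_natDegree_le (hP n m).2.le, (h₁ n m).1, (h₂ n m).1⟩⟩

theorem isPerfectSystem_of_orthogonality {l₁ l₂ : ℂ[X] →ₗ[ℂ] ℂ} {P : ℕ → ℕ → ℂ[X]}
    (hP : ∀ n m, (P n m).Monic ∧ (P n m).natDegree = n + m)
    (h₁ : ∀ n m, HasOrthogonality l₁ n (P n m)) (h₂ : ∀ n m, HasOrthogonality l₂ m (P n m)) :
    IsPerfectSystem (seriesAtInfinity fun j => l₁ (X ^ j))
      (seriesAtInfinity fun j => l₂ (X ^ j)) := by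
  intro n m
  have key : ∀ Q, IsSolution (seriesAtInfinity fun j => l₁ (X ^ j))
      (seriesAtInfinity fun j => l₂ (X ^ j)) n m Q → ∃ c : ℂ, Q = C c * P n m := by
    intro Q hQ
    obtain ⟨hd, hQ₁, hQ₂⟩ := (isSolution_moments_iff _ _ _ _ _).mp hQ
    exact eq_C_mul_of_orthogonality hP h₁ h₂ n m hd hQ₁ hQ₂
  refine ⟨⟨P n m, (hP n m).1.ne_zero,
    (isHermitePadePolynomial_of_orthogonality hP h₁ h₂ n m).2⟩, ?_, ?_⟩
  · intro R Q hR hR0 hQ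
    obtain ⟨r, rfl⟩ := key R hR
    obtain ⟨q, rfl⟩ := key Q hQ
    have hr : r ≠ 0 := by rintro rfl; simp at hR0
    exact ⟨q / r, by rw [← mul_assoc, ← C_mul, div_mul_cancel₀ _ hr]⟩
  · intro R hR hR0
    obtain ⟨r, rfl⟩ := key R hR
    have hr : r ≠ 0 := by rintro rfl; simp at hR0
    rw [natDegree_C_mul hr, (hP n m).2]

/-! ### Nearest-neighbour recurrences -/

namespace SatisfiesRecurrences

variable {a b c d : ℕ → ℕ → ℂ} {P : ℕ → ℕ → ℂ[X]}

theorem unique {P' : ℕ → ℕ → ℂ[X]} (h : SatisfiesRecurrences a b c d P)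
    (h' : SatisfiesRecurrences a b c d P') : P = P' := by
  have key : ∀ N n m, n + m = N → P n m = P' n m := by
    intro N
    induction N using Nat.strong_induction_on with
    | _ N ih =>
      have left : ∀ n m, n + m < N → leftNeighbour P n m = leftNeighbour P' n m := by
        rintro (_ | n) m hN
        · rfl
        · exact ih _ (by omega) n m rfl
      have lower : ∀ n m, n + m < N → lowerNeighbour P n m = lowerNeighbour P' n m := by
        rintro n (_ | m) hN
        · rfl
        · exact ih _ (by omega) n m rfl
      rintro (_ | n) m hN
      · rcases m with _ | m
        · rw [h.init, h'.init]
        · rw [h.up, h'.up, left _ _ (by omega), lower _ _ (by omega), ih _ (by omega) 0 m rfl]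
      · rw [h.right, h'.right, left _ _ (by omega), lower _ _ (by omega), ih _ (by omega) n m rfl]
  funext n m
  exact key _ n m rfl

theorem up_eq_right_add (h : SatisfiesRecurrences a b c d P) (n m : ℕ) :
    P n (m + 1) = P (n + 1) m + C (c n m - d n m) * P n m := by
  rw [h.up, h.right, C_sub]
  ring

/-- The symmetry that turns the construction of `l₁` into that of `l₂`. -/
theorem transpose (h : SatisfiesRecurrences a b c d P) :
    SatisfiesRecurrences (fun n m => b m n) (fun n m => a m n) (fun n m => d m n)
      (fun n m => c m n) (fun n m => P m n) := by
  have left : ∀ n m, leftNeighbour (fun n m => P m n) n m = lowerNeighbour P m n := by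
    rintro (_ | n) m <;> rfl
  have lower : ∀ n m, lowerNeighbour (fun n m => P m n) n m = leftNeighbour P m n := by
    rintro n (_ | m) <;> rfl
  refine ⟨h.init, fun n m => ?_, fun n m => ?_⟩
  · rw [left, lower, h.up]; ring
  · rw [left, lower, h.right]; ring

theorem firstRow_one (h : SatisfiesRecurrences a b c d P) : P 1 0 = X - C (c 0 0) := by
  rw [h.right, h.init]
  simp [leftNeighbour, lowerNeighbour]

theorem firstRow_threeTerm (h : SatisfiesRecurrences a b c d P) (n : ℕ) :
    P (n + 2) 0 = (X - C (c (n + 1) 0)) * P (n + 1) 0 - C (a (n + 1) 0) * P n 0 := by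
  rw [h.right]
  simp [leftNeighbour, lowerNeighbour]

theorem monic_natDegree (h : SatisfiesRecurrences a b c d P) (n m : ℕ) :
    (P n m).Monic ∧ (P n m).natDegree = n + m :=
  monic_natDegree_of_firstRow h.up_eq_right_add
    (monic_natDegree_of_threeTerm (p := fun n => P n 0) (c := fun n => c n 0)
      (a := fun n => a n 0) h.init h.firstRow_one h.firstRow_threeTerm) n m

theorem exists_orthogonality (h : SatisfiesRecurrences a b c d P) (ha : ∀ n, a (n + 1) 0 ≠ 0)
    (hcd : ∀ n m, c n m - d n m ≠ 0) :
    ∃ l : ℂ[X] →ₗ[ℂ] ℂ, ∀ n m, HasOrthogonality l n (P n m) := by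
  obtain ⟨l, hl⟩ := exists_functional_of_threeTerm (p := fun n => P n 0) (c := fun n => c n 0)
    (a := fun n => a n 0) h.init h.firstRow_one h.firstRow_threeTerm ha
  exact ⟨l, HasOrthogonality.of_firstRow h.up_eq_right_add hcd hl⟩

end SatisfiesRecurrences

/-! ### The zero curvature condition -/

section ZeroCurvature

variable {A : ℕ → ℕ → Matrix (Fin 3) (Fin 3) ℂ}

theorem entries_ne_zero_of_isUnit_matL {n m : ℕ} (h : IsUnit (matL A n m)) :
    A (n + 1) m 1 0 ≠ 0 ∧ A n m 0 1 ≠ 0 := by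
  rw [Matrix.isUnit_iff_isUnit_det] at h
  have hd : (matL A n m).det = C (A (n + 1) m 1 0 * A n m 0 1) := by
    simp [matL, Matrix.det_fin_three]
    ring
  rw [hd, isUnit_C, isUnit_iff_ne_zero] at h
  exact mul_ne_zero_iff.mp h

theorem entries_ne_zero_of_isUnit_matM {n m : ℕ} (h : IsUnit (matM A n m)) :
    A n (m + 1) 2 0 ≠ 0 ∧ A n m 0 2 ≠ 0 := by
  rw [Matrix.isUnit_iff_isUnit_det] at h
  have hd : (matM A n m).det = C (A n (m + 1) 2 0 * A n m 0 2) := by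
    simp [matM, Matrix.det_fin_three]
    ring
  rw [hd, isUnit_C, isUnit_iff_ne_zero] at h
  exact mul_ne_zero_iff.mp h

theorem ZeroCurvature.up_entry_eq (h : ZeroCurvature (matL A) (matM A)) (n m : ℕ) :
    A n (m + 1) 0 1 = A n m 0 1 * (coeffC A n m - coeffD A n m) := by
  have h01 := congrFun (congrFun (h n m) 0) 1
  simp only [matL, matM, Matrix.sub_apply, Matrix.mul_apply, Fin.sum_univ_three] at h01
  -- The z-terms of this entry cancel, so evaluating at 0 loses nothing.
  have h0 := congrArg (eval 0) h01
  simp at h0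
  simp only [coeffC, coeffD]
  linear_combination h0

/-- The solution of the linear system with transition matrices `matL A`, `matM A` starting with
`(1, 0, 0)`, computed along the paths that go right first. -/
noncomputable def waveVector (A : ℕ → ℕ → Matrix (Fin 3) (Fin 3) ℂ) : ℕ → ℕ → Fin 3 → ℂ[X]
  | 0, 0 => ![1, 0, 0]
  | n + 1, 0 => (matL A n 0).mulVec (waveVector A n 0)
  | n, m + 1 => (matM A n m).mulVec (waveVector A n m)

theorem waveVector_up (n m : ℕ) :
    waveVector A n (m + 1) = (matM A n m).mulVec (waveVector A n m) := by
  cases n <;> simp only [waveVector]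

/-- Path independence: zero curvature commutes the right step past each up step. -/
theorem waveVector_right (h : ZeroCurvature (matL A) (matM A)) (n m : ℕ) :
    waveVector A (n + 1) m = (matL A n m).mulVec (waveVector A n m) := by
  induction m with
  | zero => simp only [waveVector]
  | succ m ih =>
    rw [waveVector_up, waveVector_up, ih, Matrix.mulVec_mulVec, Matrix.mulVec_mulVec,
      ← sub_eq_zero.mp (h n m).symm]

/-- The second row of `matL` reads only the first component. On the left edge no right step
precedes; there `matM` adds a multiple of `A 0 (m + 1) 1 0 = 0`, so the initial zero persists. -/
theorem waveVector_snd (h : ZeroCurvature (matL A) (matM A)) (ha : ∀ m, A 0 m 1 0 = 0) (n m : ℕ) :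
    waveVector A n m 1 = C (A n m 1 0) * leftNeighbour (fun n m => waveVector A n m 0) n m := by
  cases n with
  | succ n =>
    rw [waveVector_right h]
    simp [matL, Matrix.mulVec, dotProduct, Fin.sum_univ_three, leftNeighbour]
  | zero =>
    rw [ha, C_0, zero_mul]
    induction m with
    | zero => simp [waveVector]
    | succ m ih =>
      rw [waveVector_up]
      simp [matM, Matrix.mulVec, dotProduct, Fin.sum_univ_three, ih, ha]

theorem waveVector_trd (h : ZeroCurvature (matL A) (matM A)) (hb : ∀ n, A n 0 2 0 = 0) (n m : ℕ) :
    waveVector A n m 2 = C (A n m 2 0) * lowerNeighbour (fun n m => waveVector A n m 0) n m := by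
  cases m with
  | succ m =>
    rw [waveVector_up]
    simp [matM, Matrix.mulVec, dotProduct, Fin.sum_univ_three, lowerNeighbour]
  | zero =>
    rw [hb, C_0, zero_mul]
    induction n with
    | zero => simp [waveVector]
    | succ n ih =>
      rw [waveVector_right h]
      simp [matL, Matrix.mulVec, dotProduct, Fin.sum_univ_three, ih, hb]

theorem satisfiesRecurrences_waveVector (h : ZeroCurvature (matL A) (matM A))
    (ha : ∀ m, A 0 m 1 0 = 0) (hb : ∀ n, A n 0 2 0 = 0) :
    SatisfiesRecurrences (coeffA A) (coeffB A) (coeffC A) (coeffD A)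
      (fun n m => waveVector A n m 0) := by
  refine ⟨by simp [waveVector], fun n m => ?_, fun n m => ?_⟩
  · have h0 := congrFun (waveVector_right h n m) 0
    rw [h0, Matrix.mulVec, dotProduct, Fin.sum_univ_three, waveVector_snd h ha,
      waveVector_trd h hb]
    simp only [matL, coeffA, coeffB, coeffC, Matrix.of_apply, Matrix.cons_val, C_mul, C_neg, C_sub]
    ring
  · have h0 := congrFun (waveVector_up (A := A) n m) 0
    rw [h0, Matrix.mulVec, dotProduct, Fin.sum_univ_three, waveVector_snd h ha,
      waveVector_trd h hb]
    simp only [matM, coeffA, coeffB, coeffD, Matrix.of_apply, Matrix.cons_val, C_mul, C_neg, C_sub]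
    ring

end ZeroCurvature

end HermitePade

theorem proposition4p5
    (A : ℕ → ℕ → Matrix (Fin 3) (Fin 3) ℂ)
    (hL : ∀ n m : ℕ, IsUnit (matL A n m))
    (hM : ∀ n m : ℕ, IsUnit (matM A n m))
    (hZC : ZeroCurvature (matL A) (matM A))
    (ha : ∀ m : ℕ, coeffA A 0 m = 0)
    (hb : ∀ n : ℕ, coeffB A n 0 = 0) :
    (∀ n m : ℕ, coeffA A (n + 1) m ≠ 0 ∧ coeffB A n (m + 1) ≠ 0) ∧
    (∃! P : ℕ → ℕ → Polynomial ℂ,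
      SatisfiesRecurrences (coeffA A) (coeffB A) (coeffC A) (coeffD A) P) ∧
    ∃ s₁ s₂ : ℕ → ℂ,
      IsPerfectSystem (seriesAtInfinity s₁) (seriesAtInfinity s₂) ∧
      ∀ P : ℕ → ℕ → Polynomial ℂ,
        SatisfiesRecurrences (coeffA A) (coeffB A) (coeffC A) (coeffD A) P →
        ∀ n m : ℕ, IsHermitePadePolynomial (seriesAtInfinity s₁) (seriesAtInfinity s₂) n m (P n m) := by
  -- The other factor of `coeffA A 0 m` is nonzero by invertibility.
  have ha' : ∀ m, A 0 m 1 0 = 0 := fun m =>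
    (mul_eq_zero.mp (ha m)).resolve_right (entries_ne_zero_of_isUnit_matL (hL 0 m)).2
  have hb' : ∀ n, A n 0 2 0 = 0 := fun n =>
    (mul_eq_zero.mp (hb n)).resolve_right (entries_ne_zero_of_isUnit_matM (hM n 0)).2
  have hA : ∀ n m, coeffA A (n + 1) m ≠ 0 := fun n m =>
    mul_ne_zero (entries_ne_zero_of_isUnit_matL (hL n m)).1
      (entries_ne_zero_of_isUnit_matL (hL (n + 1) m)).2
  have hB : ∀ n m, coeffB A n (m + 1) ≠ 0 := fun n m =>
    mul_ne_zero (entries_ne_zero_of_isUnit_matM (hM n m)).1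
      (entries_ne_zero_of_isUnit_matM (hM n (m + 1))).2
  -- Otherwise `A n (m + 1) 0 1` would vanish and `matL A n (m + 1)` would be singular.
  have hcd : ∀ n m, coeffC A n m - coeffD A n m ≠ 0 := fun n m h0 =>
    (entries_ne_zero_of_isUnit_matL (hL n (m + 1))).2 (by rw [hZC.up_entry_eq, h0, mul_zero])
  have hdc : ∀ n m, coeffD A m n - coeffC A m n ≠ 0 := fun n m h0 =>
    hcd m n (by rw [← neg_sub, h0, neg_zero])
  have hR := satisfiesRecurrences_waveVector hZC ha' hb'
  obtain ⟨l₁, h₁⟩ := hR.exists_orthogonality (fun n => hA n 0) hcd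
  obtain ⟨l₂, h₂⟩ := hR.transpose.exists_orthogonality (fun m => hB 0 m) hdc
  have h₂' := fun n m => h₂ m n
  refine ⟨fun n m => ⟨hA n m, hB n m⟩, ⟨_, hR, fun P hP => hP.unique hR⟩,
    fun j => l₁ (Polynomial.X ^ j), fun j => l₂ (Polynomial.X ^ j),
    isPerfectSystem_of_orthogonality hR.monic_natDegree h₁ h₂', fun P hP => ?_⟩
  rw [hP.unique hR]
  exact isHermitePadePolynomial_of_orthogonality hR.monic_natDegree h₁ h₂'
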